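/- Let $p\ge 0$ be an integer, let $a<b$ be real numbers and put $K=\{a\}\cup[b,\infty)$. A $p\times p$ matrix polynomial is a matrix $H\in M_p(\mathbb R[x])$; a symmetric square is a matrix polynomial of the form $H^TH$; and the degree of a matrix polynomial is the largest degree of its entries ($-\infty$ for the zero polynomial). (1) Let $F\in M_p(\mathbb R[x])$ be symmetric, $F=F^T$, and such that $F(x)$ is positive semidefinite for every $x\in K$. Then there exist $G_0,G_1,G_2,G_3\in M_p(\mathbb R[x])$, each of which is a sum of at most two symmetric squares, such that $$F=G_0+(x-a)\,G_1+(x-a)(x-b)\,G_2+(x-a)^2(x-b)\,G_3,$$ and each of the four summands $G_0$, $(x-a)G_1$, $(x-a)(x-b)G_2$, $(x-a)^2(x-b)G_3$ has degree at most $\deg F$. (2) The matrix preordering generated by the natural description of $K$ is saturated. Here the natural description of a closed semialgebraic set $L\subseteq\mathbb R$ consists of $x-c$ if $L$ has a least element $c$, of $d-x$ if $L$ has a greatest element $d$, and of $(x-c)(x-d)$ for all $c<d$ in $L$ with $(c,d)\cap L=\emptyset$. The matrix preordering generated by a set $S$ of polynomials is the set of all finite sums of terms $g\,\sigma$, where $g$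 is a product of distinct elements of $S$ (the empty product $1$ is allowed) and $\sigma$ is a finite sum of $p\times p$ symmetric squares. It is saturated if it equals the set of all symmetric $p\times p$ matrix polynomials that are positive semidefinite on $\{t\in\mathbb R: g(t)\ge 0\text{ for all }g\in S\}$. Moreover, for the natural description $S$ of $K$, one has $\{t\in\mathbb R: g(t)\ge 0\text{ for all }g\in S\}=K$. -/

import Mathlib

open Polynomial

noncomputable section

namespace MatPoly

/-- The algebra of real `p × p` matrix polynomials. -/
abbrev MPoly (p : ℕ) : Type := Matrix (Fin p) (Fin p) ℝ[X]

/-- The degree of a matrix polynomial: the largest degree of an entry, which is the largest `n`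
such that the coefficient matrix of `X ^ n` is nonzero; it is `⊥` for the zero polynomial. -/
def deg {p : ℕ} (F : MPoly p) : WithBot ℕ :=
  Finset.univ.sup fun ij : Fin p × Fin p => (F ij.1 ij.2).degree

/-- The value of a matrix polynomial at a real point. -/
def evalAt {p : ℕ} (x : ℝ) (F : MPoly p) : Matrix (Fin p) (Fin p) ℝ :=
  F.map (Polynomial.eval x)

/-- `F` is positive semidefinite at every point of `K`. -/
def PsdOn {p : ℕ} (F : MPoly p) (K : Set ℝ) : Prop :=
  ∀ x ∈ K, (evalAt x F).PosSemidef

/-- The symmetric matrix polynomials that are positive semidefinite on `K`. -/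
def positives (p : ℕ) (K : Set ℝ) : Set (MPoly p) :=
  {F | F.IsSymm ∧ PsdOn F K}

/-- `G` is a sum of at most two symmetric squares (a summand may be zero). -/
def IsSumTwoSquares {p : ℕ} (G : MPoly p) : Prop :=
  ∃ H₁ H₂ : MPoly p, G = H₁.transpose * H₁ + H₂.transpose * H₂

/-- The set of all finite sums of symmetric squares. -/
def sumSquares (p : ℕ) : AddSubmonoid (MPoly p) :=
  AddSubmonoid.closure (Set.range fun H : MPoly p => H.transpose * H)

/-- The set of common nonnegativity of the polynomials in `S`. -/
def nonnegSet (S : Set ℝ[X]) : Set ℝ :=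
  {x | ∀ g ∈ S, 0 ≤ g.eval x}

/-- The matrix preordering generated by `S`: all finite sums of terms `g σ`, where `g` is a
product of distinct elements of `S` (possibly the empty product `1`) and `σ` is a sum of
symmetric squares. -/
def preordering (p : ℕ) (S : Set ℝ[X]) : Set (MPoly p) :=
  {F | ∃ (P : Finset (Finset ℝ[X])) (σ : Finset ℝ[X] → MPoly p),
    (∀ T ∈ P, (T : Set ℝ[X]) ⊆ S ∧ σ T ∈ sumSquares p) ∧
      F = ∑ T ∈ P, (∏ g ∈ T, g) • σ T}

/-- The matrix preordering generated by `S` is saturated: it contains every symmetric matrix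
polynomial that is positive semidefinite on the set described by `S` (and nothing else). -/
def IsSaturated (p : ℕ) (S : Set ℝ[X]) : Prop :=
  preordering p S = positives p (nonnegSet S)

/-- The natural description of a closed semialgebraic set `K ⊆ ℝ`: it consists of `X - a` if `K`
has the least element `a`, of `b - X` if `K` has the greatest element `b`, and of
`(X - a) (X - b)` for every bounded gap `(a, b)` of `K`. -/
def naturalDescription (K : Set ℝ) : Set ℝ[X] :=
  {g | (∃ a, IsLeast K a ∧ g = X - C a) ∨
    (∃ b, IsGreatest K b ∧ g = C b - X) ∨
    (∃ a b, a ∈ K ∧ b ∈ K ∧ a < b ∧ Disjoint (Set.Ioo a b) K ∧ g = (X - C a) * (X - C b))}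

end MatPoly

end

/-!
A matrix polynomial `F` that is positive semidefinite on `{a} ∪ [b, ∞)` is in particular so on the
half-line `[b, ∞)`, hence `F = U + (X - b) V` with sums of squares `U`, `V` of controlled degree
(`exists_squares_of_psdOn_Ici`). At `a` this reads `F(a) = U(a) - (b - a) V(a) ≤ U(a)`. Write
`U = W₁ᵀ W₁ + W₂ᵀ W₂`. Since `0 ≤ F(a) ≤ U(a)`, composing `(W₁, W₂)` with a constant contraction
gives a single square `HᵀH ≤ U`, on the whole line, with `(HᵀH)(a) = F(a)`
(`exists_square_le`). Therefore `F - HᵀH = (X - a) B` with `B` positive semidefinite on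
`[b, ∞)`, and the half-line decomposition `B = G₁ + (X - b) G₂` finishes the proof
(`exists_decomposition`). This yields even more than required: the summand with weight
`(X - a) ^ 2 (X - b)` can be taken to be zero.

The half-line case follows from that of the whole line by the substitution `x ^ 2 + b`, separating
even and odd parts. On the line, `exists_two_squares` is the matrix Fejér–Riesz theorem. After
adding `ε (1 + X ^ 2) ^ m`, the polynomial is positive definite on the line and at infinity, and
`exists_factorization_of_posDef` factors it over `ℂ`: its determinant has a root `z`, necessarily
nonreal; if `v` is a kernel vector of the value at `z`, a constant congruence makes `v` a basis
vector `e i`, and then `X - z` divides the column `i` and `X - conj z` the row `i`. Dividing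
lowers the degree of the determinant by two. Positivity at infinity is preserved when it is
measured by the leading coefficient matrix with respect to weights `k`, the entry `(i, j)` having
degree at most `k i + k j`. A compactness argument lets `ε` tend to zero
(`exists_factorization_complex`), and real and imaginary parts of the factor give two real squares.
-/

/-! ### Evaluation, leading coefficients and congruence of matrix polynomials -/

namespace MatPoly

open Matrix ComplexConjugate

theorem map_eval_mul {R n : Type*} [CommSemiring R] [Fintype n] (A B : Matrix n n R[X]) (x : R) :
    (A * B).map (eval x) = A.map (eval x) * B.map (eval x) :=
  Matrix.map_mul (f := evalRingHom x)

theorem map_C_map_eval {R n : Type*} [CommSemiring R] (A : Matrix n n R) (x : R) :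
    (A.map C).map (eval x) = A := by
  ext; simp

theorem coeff_prod_sum_of_natDegree_le {R ι : Type*} [CommSemiring R] (s : Finset ι)
    (f : ι → R[X]) (d : ι → ℕ) (h : ∀ i ∈ s, (f i).natDegree ≤ d i) :
    (∏ i ∈ s, f i).coeff (∑ i ∈ s, d i) = ∏ i ∈ s, (f i).coeff (d i) := by
  classical
  induction s using Finset.induction_on with
  | empty => simp
  | insert a s ha ih =>
    rw [Finset.prod_insert ha, Finset.sum_insert ha, Finset.prod_insert ha,
      coeff_mul_add_eq_of_natDegree_le (h a (by simp)), ih fun i hi => h i (by simp [hi])]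
    exact (natDegree_prod_le _ _).trans (Finset.sum_le_sum fun i hi => h i (by simp [hi]))

/-- The leading coefficient matrix of `F` for the weights `k`, where the entry `F i j` is thought
of as having degree `k i + k j`. -/
def leadMatrix {n : Type*} {R : Type*} [Semiring R] (k : n → ℕ) (F : Matrix n n R[X]) :
    Matrix n n R :=
  Matrix.of fun i j => (F i j).coeff (k i + k j)

theorem coeff_det_eq_det_leadMatrix {R n : Type*} [CommRing R] [Fintype n] [DecidableEq n]
    (k : n → ℕ) (F : Matrix n n R[X]) (h : ∀ i j, (F i j).natDegree ≤ k i + k j) :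
    F.det.coeff (∑ i, k i + ∑ i, k i) = (leadMatrix k F).det := by
  rw [det_apply, det_apply, finsetSum_coeff]
  refine Finset.sum_congr rfl fun σ _ => ?_
  have hs : ∑ i, k i + ∑ i, k i = ∑ i, (k (σ i) + k i) := by
    rw [Finset.sum_add_distrib, Equiv.sum_comp σ k]
  rw [Units.smul_def, Units.smul_def, coeff_smul, hs,
    coeff_prod_sum_of_natDegree_le _ _ _ fun i _ => h _ _]
  rfl

theorem eval_map_conj (q : ℂ[X]) (z : ℂ) :
    (q.map (starRingEnd ℂ)).eval (conj z) = conj (q.eval z) := by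
  rw [eval_map, eval₂_at_apply]

/-- Complex polynomials that agree on the real line are equal. -/
theorem eq_of_eval_ofReal_eq {q r : ℂ[X]} (h : ∀ x : ℝ, q.eval (x : ℂ) = r.eval (x : ℂ)) :
    q = r :=
  eq_of_infinite_eval_eq q r <| (Set.infinite_range_of_injective Complex.ofReal_injective).mono <| by
    rintro _ ⟨x, rfl⟩
    exact h x

theorem map_conj_eq_of_isHermitian {n : Type*} {F : Matrix n n ℂ[X]}
    (h : ∀ x : ℝ, (F.map (eval (x : ℂ))).IsHermitian) (i j : n) :
    F i j = (F j i).map (starRingEnd ℂ) := by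
  refine eq_of_eval_ofReal_eq fun x => ?_
  have := (h x).apply i j
  rw [← Complex.conj_ofReal x, eval_map_conj, Complex.conj_ofReal]
  exact this.symm

section Congruence

variable {n : Type*} [Fintype n] {k : n → ℕ} {V : Matrix n n ℂ}

/-- The congruence of a matrix polynomial by a constant matrix. -/
noncomputable def constCongr (V : Matrix n n ℂ) (F : Matrix n n ℂ[X]) : Matrix n n ℂ[X] :=
  Vᴴ.map C * F * V.map C

theorem constCongr_apply (V : Matrix n n ℂ) (F : Matrix n n ℂ[X]) (j l : n) :
    constCongr V F j l = ∑ b, ∑ a, C (conj (V a j)) * F a b * C (V b l) := by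
  simp [constCongr, Matrix.mul_apply, Finset.sum_mul]

theorem map_eval_constCongr (V : Matrix n n ℂ) (F : Matrix n n ℂ[X]) (x : ℂ) :
    (constCongr V F).map (eval x) = Vᴴ * F.map (eval x) * V := by
  rw [constCongr, map_eval_mul, map_eval_mul, map_C_map_eval, map_C_map_eval]

theorem natDegree_constCongr_le (hV : ∀ a j, V a j ≠ 0 → k a ≤ k j) {F : Matrix n n ℂ[X]}
    (h : ∀ i j, (F i j).natDegree ≤ k i + k j) (j l : n) :
    (constCongr V F j l).natDegree ≤ k j + k l := by
  rw [constCongr_apply]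
  refine natDegree_sum_le_of_forall_le _ _ fun b _ => natDegree_sum_le_of_forall_le _ _ fun a _ => ?_
  by_cases ha : V a j = 0
  · simp [ha]
  by_cases hb : V b l = 0
  · simp [hb]
  exact (natDegree_mul_C_le _ _).trans <| (natDegree_C_mul_le _ _).trans <|
    (h a b).trans (add_le_add (hV a j ha) (hV b l hb))

/-- Congruence by a matrix that respects the weights acts on the leading coefficient matrix
through the part of that matrix that preserves the weights. -/
theorem leadMatrix_constCongr (hV : ∀ a j, V a j ≠ 0 → k a ≤ k j) {F : Matrix n n ℂ[X]}
    (h : ∀ i j, (F i j).natDegree ≤ k i + k j) :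
    leadMatrix k (constCongr V F) =
      (Matrix.of fun a j => if k a = k j then V a j else 0)ᴴ * leadMatrix k F *
        (Matrix.of fun a j => if k a = k j then V a j else 0) := by
  ext j l
  simp only [leadMatrix, Matrix.mul_apply, of_apply, conjTranspose_apply, constCongr_apply,
    finsetSum_coeff, Finset.sum_mul, coeff_mul_C, coeff_C_mul]
  refine Finset.sum_congr rfl fun b _ => Finset.sum_congr rfl fun a _ => ?_
  by_cases ha : V a j = 0
  · simp [ha]
  by_cases hb : V b l = 0
  · simp [hb]
  have h1 := hV a j ha
  have h2 := hV b l hb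
  by_cases e : k a = k j ∧ k b = k l
  · simp [e.1, e.2]
  · have : (F a b).coeff (k j + k l) = 0 := by
      refine coeff_eq_zero_of_natDegree_lt ((h a b).trans_lt ?_)
      omega
    rw [this]
    rcases not_and_or.mp e with e | e <;> simp [e]

variable [DecidableEq n]

theorem transvection_mul_neg (i : n) (w : n → ℂ) (hw : w i = 0) :
    (1 + vecMulVec w (Pi.single i 1)) * (1 + vecMulVec (-w) (Pi.single i 1)) =
      (1 : Matrix n n ℂ) := by
  have : vecMulVec w (Pi.single i (1 : ℂ)) * vecMulVec w (Pi.single i 1) = 0 := by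
    rw [vecMulVec_mul_vecMulVec]
    simp [hw]
  simp [mul_add, add_mul, neg_vecMulVec, this]

end Congruence

/-- The diagonal matrix polynomial that multiplies the column `i` by `X - z`. -/
noncomputable def colFactor {n : Type*} [DecidableEq n] (i : n) (z : ℂ) : Matrix n n ℂ[X] :=
  diagonal fun j => if j = i then X - C z else 1

/-- If a Hermitian matrix polynomial has a column vanishing at a nonreal point `z`, then
`X - z` can be taken out of that column and `X - conj z` out of the corresponding row. -/
theorem exists_eq_factor {n : Type*} [DecidableEq n] {F : Matrix n n ℂ[X]} {i : n}
    {z : ℂ} (hz : conj z ≠ z)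
    (hF : ∀ x : ℝ, (F.map (eval (x : ℂ))).IsHermitian) (h0 : ∀ j, (F j i).eval z = 0) :
    ∃ Q : Matrix n n ℂ[X], ∀ j l, F j l =
      (if j = i then X - C (conj z) else 1) * Q j l * (if l = i then X - C z else 1) := by
  have hrow : ∀ l, (F i l).eval (conj z) = 0 := fun l => by
    rw [map_conj_eq_of_isHermitian hF i l, eval_map_conj, h0 l, map_zero]
  suffices ∀ j l, ∃ q, F j l =
      (if j = i then X - C (conj z) else 1) * q * (if l = i then X - C z else 1) by
    choose Q hQ using this
    exact ⟨Q, hQ⟩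
  intro j l
  by_cases hj : j = i <;> by_cases hl : l = i
  · subst hj hl
    have hc : IsCoprime (X - C (conj z)) (X - C z) := isCoprime_X_sub_C_of_isUnit_sub
      (IsUnit.mk0 _ (sub_ne_zero.mpr hz))
    obtain ⟨q, hq⟩ := hc.mul_dvd (dvd_iff_isRoot.mpr (hrow l)) (dvd_iff_isRoot.mpr (h0 l))
    exact ⟨q, by simp only [if_true]; rw [hq]; ring⟩
  · subst hj
    obtain ⟨q, hq⟩ := dvd_iff_isRoot.mpr (hrow l)
    exact ⟨q, by simp [hl, hq]⟩
  · subst hl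
    obtain ⟨q, hq⟩ := dvd_iff_isRoot.mpr (h0 j)
    exact ⟨q, by simp [hj, hq, mul_comm]⟩
  · exact ⟨F j l, by simp [hj, hl]⟩

end MatPoly

/-! ### Spectral factorization in the positive definite case -/

namespace MatPoly

open Matrix ComplexConjugate
open scoped ComplexOrder MatrixOrder

section Step

variable {n : Type*} {k : n → ℕ} {F : Matrix n n ℂ[X]}

theorem exists_eval_det_eq_zero [Fintype n] [DecidableEq n] (hF : ∀ i j, (F i j).natDegree ≤ k i + k j)
    (hL : (leadMatrix k F).PosDef) (hk : ∑ i, k i ≠ 0) : ∃ z, F.det.eval z = 0 := by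
  refine Complex.exists_root ?_
  rw [← natDegree_pos_iff_degree_pos]
  have h := coeff_det_eq_det_leadMatrix k F hF
  have : F.det.coeff (∑ i, k i + ∑ i, k i) ≠ 0 := by rw [h]; exact hL.det_pos.ne'
  have := le_natDegree_of_ne_zero this
  omega

/-- Positivity of the leading coefficient matrix keeps the kernel vectors of the values of `F`
away from the coordinates of weight zero. -/
theorem exists_pos_weight_of_mulVec_eq_zero [Fintype n] [DecidableEq n]
    (hF : ∀ i j, (F i j).natDegree ≤ k i + k j) (hL : (leadMatrix k F).PosDef) {z : ℂ} {v : n → ℂ} (hv : v ≠ 0)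
    (hz : F.map (eval z) *ᵥ v = 0) : ∃ i, v i ≠ 0 ∧ k i ≠ 0 := by
  by_contra! h
  refine (hL.dotProduct_mulVec_pos hv).ne' ?_
  rw [← sub_zero (leadMatrix k F *ᵥ v), ← hz]
  simp only [dotProduct, mulVec, Pi.sub_apply, Pi.star_apply]
  refine Finset.sum_eq_zero fun a _ => ?_
  by_cases ha : v a = 0
  · simp [ha]
  rw [← Finset.sum_sub_distrib, Finset.sum_eq_zero, mul_zero]
  intro b _
  by_cases hb : v b = 0
  · simp [hb]
  have hd := hF a b
  rw [h a ha, h b hb] at hd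
  rw [map_apply, eq_C_of_natDegree_le_zero hd]
  simp [leadMatrix, h a ha, h b hb]

theorem exists_max_weight [Fintype n] {v : n → ℂ} (h : ∃ i, v i ≠ 0 ∧ k i ≠ 0) :
    ∃ i, v i ≠ 0 ∧ k i ≠ 0 ∧ ∀ j, v j ≠ 0 → k j ≤ k i := by
  obtain ⟨i₀, h1, h2⟩ := h
  obtain ⟨i, hi, hmax⟩ := Finset.exists_max_image (Finset.univ.filter fun j => v j ≠ 0) k
    ⟨i₀, by simp [h1]⟩
  refine ⟨i, by simpa using hi, ?_, fun j hj => hmax j (by simp [hj])⟩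
  have := hmax i₀ (by simp [h1])
  omega

/-- Dividing the column `i` by `X - z` and the row `i` by `X - conj z` lowers the weight of `i`
by one and keeps the leading coefficient matrix. -/
theorem natDegree_and_leadMatrix_of_eq_factor [DecidableEq n] {i : n} {z : ℂ} {k' : n → ℕ}
    (hk : ∀ j, k j = k' j + if j = i then 1 else 0)
    (hF : ∀ i j, (F i j).natDegree ≤ k i + k j) {Q : Matrix n n ℂ[X]}
    (hQ : ∀ j l, F j l =
      (if j = i then X - C (conj z) else 1) * Q j l * (if l = i then X - C z else 1)) :
    (∀ j l, (Q j l).natDegree ≤ k' j + k' l) ∧ leadMatrix k' Q = leadMatrix k F := by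
  have hm : ∀ (j : n) (c : ℂ), (if j = i then X - C c else 1 : ℂ[X]).Monic ∧
      (if j = i then X - C c else 1 : ℂ[X]).natDegree = if j = i then 1 else 0 := by
    intro j c
    split_ifs <;> simp [monic_X_sub_C]
  have hd : ∀ j l, (Q j l).natDegree ≤ k' j + k' l := by
    intro j l
    by_cases h0 : Q j l = 0
    · simp [h0]
    have h := hF j l
    rw [hQ, natDegree_mul (mul_ne_zero (hm j _).1.ne_zero h0) (hm l z).1.ne_zero,
      natDegree_mul (hm j _).1.ne_zero h0, (hm j _).2, (hm l _).2, hk j, hk l] at h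
    omega
  refine ⟨hd, ?_⟩
  ext j l
  have e : k j + k l = (if j = i then 1 else 0) + (k' j + k' l) + (if l = i then 1 else 0) := by
    rw [hk j, hk l]
    omega
  have hlead : ∀ (j : n) (c : ℂ),
      (if j = i then X - C c else 1 : ℂ[X]).coeff (if j = i then 1 else 0) = 1 := by
    intro j c
    rw [← (hm j c).2]
    exact (hm j c).1
  simp only [leadMatrix, of_apply]
  rw [hQ, e, coeff_mul_add_eq_of_natDegree_le _ (hm l z).2.le,
    coeff_mul_add_eq_of_natDegree_le (hm j _).2.le (hd j l), hlead, hlead, one_mul, mul_one]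
  exact natDegree_mul_le_of_le (hm j _).2.le (hd j l)

theorem map_eval_colFactor [DecidableEq n] (i : n) (z x : ℂ) :
    (colFactor i z).map (eval x) = diagonal fun j => if j = i then x - z else 1 := by
  rw [colFactor, diagonal_map (by simp)]
  congr 1
  ext j
  split_ifs <;> simp

theorem map_eval_of_eq_factor [Fintype n] [DecidableEq n] {i : n} {z : ℂ} {Q : Matrix n n ℂ[X]}
    (hQ : ∀ j l, F j l =
      (if j = i then X - C (conj z) else 1) * Q j l * (if l = i then X - C z else 1)) (x : ℝ) :
    F.map (eval (x : ℂ)) = ((colFactor i z).map (eval (x : ℂ)))ᴴ * Q.map (eval (x : ℂ)) *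
      (colFactor i z).map (eval (x : ℂ)) := by
  ext j l
  rw [map_eval_colFactor, diagonal_conjTranspose, mul_diagonal, diagonal_mul, map_apply, hQ]
  simp only [eval_mul, map_apply, Pi.star_apply]
  congr 1
  · congr 1
    split_ifs <;> simp
  · split_ifs <;> simp

theorem isUnit_map_eval_colFactor [Fintype n] [DecidableEq n] {i : n} {z x : ℂ} (h : x ≠ z) :
    IsUnit ((colFactor i z).map (eval x)) := by
  rw [map_eval_colFactor, isUnit_iff_isUnit_det, det_diagonal, isUnit_iff_ne_zero,
    Finset.prod_ne_zero_iff]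
  intro j _
  split_ifs
  · exact sub_ne_zero.mpr h
  · exact one_ne_zero

theorem natDegree_mul_colFactor_le [Fintype n] [DecidableEq n] {i : n} {z : ℂ} {k' : n → ℕ}
    (hk : ∀ j, k j = k' j + if j = i then 1 else 0) {H : Matrix n n ℂ[X]}
    (hH : ∀ j l, (H j l).natDegree ≤ k' l) (j l : n) :
    ((H * colFactor i z) j l).natDegree ≤ k l := by
  rw [colFactor, mul_diagonal, hk l]
  refine natDegree_mul_le_of_le (hH j l) ?_
  split_ifs <;> simp

theorem natDegree_mul_map_C_le [Fintype n] {V : Matrix n n ℂ} (hV : ∀ a j, V a j ≠ 0 → k a ≤ k j)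
    {H : Matrix n n ℂ[X]} (hH : ∀ j l, (H j l).natDegree ≤ k l) (j l : n) :
    ((H * V.map C) j l).natDegree ≤ k l := by
  rw [Matrix.mul_apply]
  refine natDegree_sum_le_of_forall_le _ _ fun a _ => ?_
  by_cases ha : V a l = 0
  · simp [ha]
  · exact (natDegree_mul_C_le _ _).trans ((hH j a).trans (hV a l ha))

theorem weight_le_of_transvection_ne_zero [DecidableEq n] {i : n} {w : n → ℂ}
    (hw : ∀ j, w j ≠ 0 → k j ≤ k i) (a j : n) (h : (1 + vecMulVec w (Pi.single i 1) : Matrix n n ℂ) a j ≠ 0) : k a ≤ k j := by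
  by_cases haj : a = j
  · rw [haj]
  by_cases hji : j = i
  · subst hji
    refine hw a fun h0 => h ?_
    simp [vecMulVec_apply, haj, h0]
  · simp [vecMulVec_apply, haj, hji] at h

theorem weightPart_transvection [DecidableEq n] (i : n) (w : n → ℂ) :
    (Matrix.of fun a j => if k a = k j then
      (1 + vecMulVec w (Pi.single i 1) : Matrix n n ℂ) a j else 0) =
      1 + vecMulVec (fun a => if k a = k i then w a else 0) (Pi.single i 1) := by
  ext a j
  by_cases hji : j = i
  · subst hji
    by_cases haj : a = j
    · subst haj
      simp [vecMulVec_apply]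
    · by_cases hk : k a = k j <;> simp [vecMulVec_apply, haj, hk]
  · by_cases haj : a = j
    · subst haj
      simp [vecMulVec_apply, hji]
    · simp [vecMulVec_apply, haj, hji]

end Step

/-- Spectral factorization of a Hermitian matrix polynomial that is positive definite on the real
line and whose leading coefficient matrix, for suitable weights, is positive definite. The proof
is by induction on the sum of the weights, half the degree of the determinant. -/
theorem exists_factorization_of_posDef {n : Type*} [Fintype n] [DecidableEq n] (N : ℕ) :
    ∀ (k : n → ℕ) (F : Matrix n n ℂ[X]), ∑ i, k i = N →
      (∀ x : ℝ, (F.map (eval (x : ℂ))).PosDef) → (∀ i j, (F i j).natDegree ≤ k i + k j) →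
      (leadMatrix k F).PosDef →
      ∃ H : Matrix n n ℂ[X], (∀ i j, (H i j).natDegree ≤ k j) ∧
        ∀ x : ℝ, F.map (eval (x : ℂ)) = (H.map (eval (x : ℂ)))ᴴ * H.map (eval (x : ℂ)) := by
  induction N with
  | zero =>
    intro k F hN _ hF hL
    have hk : ∀ i, k i = 0 := by simpa using hN
    obtain ⟨B, hB⟩ := CStarAlgebra.nonneg_iff_eq_star_mul_self.mp hL.posSemidef.nonneg
    refine ⟨B.map C, fun i j => by simp, fun x => ?_⟩
    rw [map_C_map_eval, ← star_eq_conjTranspose, ← hB]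
    ext i j
    have hd := hF i j
    rw [hk i, hk j] at hd
    rw [map_apply, eq_C_of_natDegree_le_zero hd]
    simp [leadMatrix, hk]
  | succ N ih =>
    intro k F hN hpos hF hL
    obtain ⟨z, hz⟩ := exists_eval_det_eq_zero hF hL (by omega)
    have hdet : (F.map (eval z)).det = 0 := by
      rw [← hz, ← coe_evalRingHom, RingHom.map_det]
      rfl
    have hzr : conj z ≠ z := fun h => by
      obtain ⟨x, rfl⟩ := Complex.conj_eq_iff_real.mp h
      exact (hpos x).det_pos.ne' hdet
    obtain ⟨v, hv, hFv⟩ := exists_mulVec_eq_zero_iff.mpr hdet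
    obtain ⟨i, hvi, hki, hmax⟩ :=
      exists_max_weight (exists_pos_weight_of_mulVec_eq_zero hF hL hv hFv)
    -- The transvection `V` maps the basis vector `i` to the multiple of `v` with `i`-entry `1`.
    set w : n → ℂ := fun j => if j = i then 0 else (v i)⁻¹ * v j with hwdef
    have hwi : w i = 0 := by simp [hwdef]
    have hw : ∀ j, w j ≠ 0 → k j ≤ k i := fun j hj => hmax j fun h => hj (by simp [hwdef, h])
    have hw' : ∀ j, (-w) j ≠ 0 → k j ≤ k i := fun j hj => hw j fun h => hj (by simp [h])
    set V : Matrix n n ℂ := 1 + vecMulVec w (Pi.single i 1) with hV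
    set V' : Matrix n n ℂ := 1 + vecMulVec (-w) (Pi.single i 1) with hV'
    have hVV' : V * V' = 1 := transvection_mul_neg i w hwi
    have hVi : V *ᵥ Pi.single i 1 = (v i)⁻¹ • v := by
      ext j
      by_cases hj : j = i
      · subst hj
        simp [hV, vecMulVec_apply, hwi, hvi]
      · simp [hV, vecMulVec_apply, hwdef, hj]
    have hunit : IsUnit V := IsUnit.of_mul_eq_one V' hVV'
    have hVk : ∀ a j, V a j ≠ 0 → k a ≤ k j := weight_le_of_transvection_ne_zero (k := k) hw
    have hcpos : ∀ x : ℝ, ((constCongr V F).map (eval (x : ℂ))).PosDef := fun x => by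
      rw [map_eval_constCongr]
      exact hunit.posDef_star_left_conjugate_iff.mpr (hpos x)
    have hcdeg := natDegree_constCongr_le hVk hF
    have hclead : (leadMatrix k (constCongr V F)).PosDef := by
      rw [leadMatrix_constCongr hVk hF, hV, weightPart_transvection]
      refine IsUnit.posDef_star_left_conjugate_iff ?_ |>.mpr hL
      exact IsUnit.of_mul_eq_one _ (transvection_mul_neg i _ (by simp [hwi]))
    have hcol : ∀ j, (constCongr V F j i).eval z = 0 := fun j => by
      have h : (constCongr V F).map (eval z) *ᵥ Pi.single i 1 = 0 := by
        rw [map_eval_constCongr, ← mulVec_mulVec, ← mulVec_mulVec, hVi, mulVec_smul, hFv]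
        simp
      simpa using congrFun h j
    obtain ⟨Q, hQ⟩ := exists_eq_factor hzr (fun x => (hcpos x).isHermitian) hcol
    have hk : ∀ j, k j = Function.update k i (k i - 1) j + if j = i then 1 else 0 := by
      intro j
      by_cases hj : j = i
      · subst hj
        simp
        omega
      · simp [hj]
    obtain ⟨hQdeg, hQlead⟩ := natDegree_and_leadMatrix_of_eq_factor hk hcdeg hQ
    have hsum : ∑ j, Function.update k i (k i - 1) j = N := by
      have h := hN
      rw [Finset.sum_congr rfl fun j _ => hk j, Finset.sum_add_distrib] at h
      simpa using h
    have hQpos : ∀ x : ℝ, (Q.map (eval (x : ℂ))).PosDef := fun x => by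
      have h := hcpos x
      rw [map_eval_of_eq_factor hQ x] at h
      exact (isUnit_map_eval_colFactor fun h0 => hzr (by rw [← h0, Complex.conj_ofReal])
        ).posDef_star_left_conjugate_iff.mp h
    obtain ⟨H, hHdeg, hH⟩ := ih _ Q hsum hQpos hQdeg (hQlead ▸ hclead)
    refine ⟨H * colFactor i z * V'.map C, natDegree_mul_map_C_le
      (weight_le_of_transvection_ne_zero (k := k) hw') (natDegree_mul_colFactor_le hk hHdeg),
      fun x => ?_⟩
    have h1 := map_eval_constCongr V F x
    rw [map_eval_of_eq_factor hQ x, hH x] at h1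
    rw [map_eval_mul, map_eval_mul, map_C_map_eval]
    calc F.map (eval (x : ℂ)) = (V * V')ᴴ * F.map (eval (x : ℂ)) * (V * V') := by
          rw [hVV']; simp
      _ = V'ᴴ * (Vᴴ * F.map (eval (x : ℂ)) * V) * V' := by
          simp only [conjTranspose_mul, Matrix.mul_assoc]
      _ = _ := by
          rw [← h1]
          simp only [conjTranspose_mul, Matrix.mul_assoc]

end MatPoly

/-! ### Positive semidefinite matrix polynomials on the real line -/

namespace MatPoly

open Matrix ComplexConjugate Filter Topology
open scoped ComplexOrder MatrixOrder

/-- A polynomial that is nonnegative on the real line has a nonnegative coefficient at every even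
bound for its degree. -/
theorem coeff_two_mul_nonneg {q : ℝ[X]} {m : ℕ} (hq : ∀ x, 0 ≤ q.eval x)
    (hd : q.natDegree ≤ 2 * m) : 0 ≤ q.coeff (2 * m) := by
  by_contra! h
  have hn : q.natDegree = 2 * m := le_antisymm hd (le_natDegree_of_ne_zero h.ne)
  rcases Nat.eq_zero_or_pos m with rfl | hm
  · rw [eq_C_of_natDegree_le_zero hd] at hq
    have := hq 0
    simp at this h
    linarith
  · have hdeg : 0 < q.degree := natDegree_pos_iff_degree_pos.mp (by omega)
    have hl : q.leadingCoeff ≤ 0 := by rw [leadingCoeff, hn]; exact h.le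
    obtain ⟨x, hx⟩ := ((q.tendsto_atBot_of_leadingCoeff_nonpos hdeg hl).eventually
      (eventually_lt_atBot 0)).exists
    exact (hq x).not_gt hx

theorem evalAt_mul {p : ℕ} (x : ℝ) (F G : MPoly p) : evalAt x (F * G) = evalAt x F * evalAt x G :=
  map_eval_mul F G x

theorem evalAt_add {p : ℕ} (x : ℝ) (F G : MPoly p) : evalAt x (F + G) = evalAt x F + evalAt x G := by
  ext; simp [evalAt]

theorem evalAt_sub {p : ℕ} (x : ℝ) (F G : MPoly p) : evalAt x (F - G) = evalAt x F - evalAt x G := by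
  ext; simp [evalAt]

theorem evalAt_smul {p : ℕ} (x : ℝ) (g : ℝ[X]) (F : MPoly p) :
    evalAt x (g • F) = g.eval x • evalAt x F := by
  ext; simp [evalAt]

theorem evalAt_transpose {p : ℕ} (x : ℝ) (F : MPoly p) : evalAt x Fᵀ = (evalAt x F)ᵀ := rfl

/-- Matrix polynomials with the same values on an infinite set are equal. -/
theorem eq_of_evalAt_eq_on {p : ℕ} {F G : MPoly p} {K : Set ℝ} (hK : K.Infinite)
    (h : ∀ x ∈ K, evalAt x F = evalAt x G) : F = G := by
  ext1 i j
  exact eq_of_infinite_eval_eq _ _ (hK.mono fun x hx => congrFun (congrFun (h x hx) i) j)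

theorem PsdOn.isSymm {p : ℕ} {F : MPoly p} {K : Set ℝ} (hK : K.Infinite) (h : PsdOn F K) :
    F.IsSymm :=
  eq_of_evalAt_eq_on hK fun x hx => (h x hx).isHermitian

theorem posSemidef_coeff_two_mul {p m : ℕ} {F : MPoly p} (hF : PsdOn F Set.univ)
    (hd : ∀ i j, (F i j).natDegree ≤ 2 * m) :
    (F.map fun q => q.coeff (2 * m)).PosSemidef := by
  have hs := hF.isSymm Set.infinite_univ
  refine .of_dotProduct_mulVec_nonneg ?_ fun v => ?_
  · ext i j
    simp [hs.apply i j]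
  let q : ℝ[X] := ∑ i, C (v i) * ∑ j, F i j * C (v j)
  have hq : ∀ x, 0 ≤ q.eval x := fun x => by
    have := (hF x trivial).dotProduct_mulVec_nonneg v
    simpa [q, eval_finsetSum, dotProduct, mulVec, evalAt] using this
  have hqd : q.natDegree ≤ 2 * m :=
    natDegree_sum_le_of_forall_le _ _ fun i _ => (natDegree_C_mul_le _ _).trans <|
      natDegree_sum_le_of_forall_le _ _ fun j _ => (natDegree_mul_C_le _ _).trans (hd i j)
  simpa [q, finsetSum_coeff, dotProduct, mulVec] using coeff_two_mul_nonneg hq hqd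

theorem posDef_map_ofReal {n : Type*} [Fintype n] [DecidableEq n] {A : Matrix n n ℝ}
    (hA : A.PosDef) : (A.map ((↑) : ℝ → ℂ)).PosDef := by
  obtain ⟨B, hB⟩ := CStarAlgebra.nonneg_iff_eq_star_mul_self.mp hA.posSemidef.nonneg
  have h : A.map ((↑) : ℝ → ℂ) = (B.map ((↑) : ℝ → ℂ))ᴴ * B.map ((↑) : ℝ → ℂ) := by
    rw [hB]
    ext i j
    simp [Matrix.mul_apply, star_eq_conjTranspose]
  refine PosSemidef.posDef_iff_det_ne_zero ?_ |>.mpr ?_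
  · rw [h]
    exact posSemidef_conjTranspose_mul_self _
  · have : (A.map ((↑) : ℝ → ℂ)).det = (A.det : ℂ) := (RingHom.map_det Complex.ofRealHom A).symm
    rw [this]
    exact_mod_cast hA.det_pos.ne'

/-- Spectral factorization of the positive perturbation `F + ε (1 + X ^ 2) ^ m` of a
positive semidefinite matrix polynomial, which is positive definite also at infinity. -/
theorem exists_factorization_add {p m : ℕ} {F : MPoly p} (hF : PsdOn F Set.univ)
    (hd : ∀ i j, (F i j).natDegree ≤ 2 * m) {ε : ℝ} (hε : 0 < ε) :
    ∃ H : Matrix (Fin p) (Fin p) ℂ[X], (∀ i j, (H i j).natDegree ≤ m) ∧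
      ∀ x : ℝ, (evalAt x F + (ε * (x ^ 2 + 1) ^ m) • (1 : Matrix _ _ ℝ)).map ((↑) : ℝ → ℂ) =
        (H.map (eval (x : ℂ)))ᴴ * H.map (eval (x : ℂ)) := by
  have hmon : ((X ^ 2 + 1 : ℝ[X]) ^ m).Monic := (monic_X_pow_add_C 1 two_ne_zero).pow m
  have hdeg : ((X ^ 2 + 1 : ℝ[X]) ^ m).natDegree = 2 * m := by
    have : (X ^ 2 + 1 : ℝ[X]).natDegree = 2 := natDegree_X_pow_add_C (n := 2) (r := (1 : ℝ))
    rw [natDegree_pow, this, mul_comm]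
  have hcoeff : ((X ^ 2 + 1 : ℝ[X]) ^ m).coeff (2 * m) = 1 := by
    rw [← hdeg]
    exact hmon
  let P : MPoly p := F + (C ε * (X ^ 2 + 1) ^ m) • (1 : MPoly p)
  have hPdeg : ∀ i j, (P i j).natDegree ≤ m + m := fun i j => by
    have hP : P i j = F i j + C ε * (X ^ 2 + 1) ^ m * (1 : MPoly p) i j := rfl
    rw [← two_mul, hP]
    refine natDegree_add_le_of_degree_le (hd i j) ?_
    by_cases hij : i = j
    · subst hij
      rw [one_apply_eq, mul_one]
      exact (natDegree_C_mul_le _ _).trans hdeg.le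
    · simp [hij]
  have hPeval : ∀ x, evalAt x P = evalAt x F + (ε * (x ^ 2 + 1) ^ m) • (1 : Matrix _ _ ℝ) := by
    intro x
    ext i j
    by_cases hij : i = j
    · subst hij
      simp [P, evalAt]
    · simp [P, evalAt, hij]
  have hPlead : leadMatrix (fun _ => m) P = (F.map fun q => q.coeff (2 * m)) + ε • 1 := by
    ext i j
    by_cases hij : i = j
    · subst hij
      simp [P, leadMatrix, ← two_mul, hcoeff]
    · simp [P, leadMatrix, hij, ← two_mul]
  have hone : (1 : Matrix (Fin p) (Fin p) ℝ).PosDef := .one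
  have hmapeval : ∀ x : ℝ, (P.map (Polynomial.map Complex.ofRealHom)).map (eval (x : ℂ)) =
      (evalAt x P).map ((↑) : ℝ → ℂ) := fun x => by
    ext i j
    exact (eval_map _ _).trans (eval₂_at_apply Complex.ofRealHom x)
  have hpos : ∀ x : ℝ,
      ((P.map (Polynomial.map Complex.ofRealHom)).map (eval (x : ℂ))).PosDef := fun x => by
    rw [hmapeval, hPeval]
    exact posDef_map_ofReal (PosDef.posSemidef_add (hF x trivial) (hone.smul (by positivity)))
  have hlead : (leadMatrix (fun _ => m) (P.map (Polynomial.map Complex.ofRealHom))).PosDef := by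
    have : leadMatrix (fun _ => m) (P.map (Polynomial.map Complex.ofRealHom)) =
        (leadMatrix (fun _ => m) P).map ((↑) : ℝ → ℂ) := by
      ext i j
      simp [leadMatrix]
    rw [this, hPlead]
    exact posDef_map_ofReal (PosDef.posSemidef_add (posSemidef_coeff_two_mul hF hd) (hone.smul hε))
  obtain ⟨H, hH, hHx⟩ := exists_factorization_of_posDef _ (fun _ => m)
    (P.map (Polynomial.map Complex.ofRealHom)) rfl hpos
    (fun i j => natDegree_map_le.trans (hPdeg i j)) hlead
  refine ⟨H, hH, fun x => ?_⟩
  rw [← hHx, hmapeval, hPeval]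

theorem exists_re_im (q : ℂ[X]) : ∃ r s : ℝ[X], r.natDegree ≤ q.natDegree ∧
    s.natDegree ≤ q.natDegree ∧ ∀ x : ℝ, q.eval (x : ℂ) = ⟨r.eval x, s.eval x⟩ := by
  refine ⟨∑ i ∈ Finset.range (q.natDegree + 1), C (q.coeff i).re * X ^ i,
    ∑ i ∈ Finset.range (q.natDegree + 1), C (q.coeff i).im * X ^ i, ?_, ?_, fun x => ?_⟩
  · exact natDegree_sum_le_of_forall_le _ _ fun i hi => (natDegree_C_mul_X_pow_le _ _).trans
      (Finset.mem_range_succ_iff.mp hi)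
  · exact natDegree_sum_le_of_forall_le _ _ fun i hi => (natDegree_C_mul_X_pow_le _ _).trans
      (Finset.mem_range_succ_iff.mp hi)
  · rw [eval_eq_sum_range]
    apply Complex.ext <;>
    simp [eval_finsetSum, ← Complex.ofReal_pow]

/-- The factorizations of the perturbations of `F` have a limit point. The values of the factors at
`m + 1` nodes are bounded by the diagonal of `F`, so they converge along a subsequence, and by
Lagrange interpolation the factors then converge at every point. -/
theorem exists_factorization_complex {p m : ℕ} {F : MPoly p} (hF : PsdOn F Set.univ)
    (hd : ∀ i j, (F i j).natDegree ≤ 2 * m) :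
    ∃ H : Matrix (Fin p) (Fin p) ℂ[X], (∀ i j, (H i j).natDegree ≤ m) ∧
      ∀ x : ℝ, (evalAt x F).map ((↑) : ℝ → ℂ) =
        (H.map (eval (x : ℂ)))ᴴ * H.map (eval (x : ℂ)) := by
  set ε : ℕ → ℝ := fun t => 1 / ((t : ℝ) + 1) with hε
  have hεpos : ∀ t, 0 < ε t := fun t => by positivity
  have hεle : ∀ t, ε t ≤ 1 := fun t => by
    rw [hε]
    exact div_le_one_of_le₀ (by simp) (by positivity)
  choose H hH hHx using fun t => exists_factorization_add hF hd (hεpos t)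
  have hentry : ∀ t (x : ℝ) i j, ((F i j).eval x + (ε t * (x ^ 2 + 1) ^ m) *
      (1 : Matrix (Fin p) (Fin p) ℝ) i j : ℂ) =
      ∑ l, conj ((H t l i).eval (x : ℂ)) * (H t l j).eval (x : ℂ) := fun t x i j => by
    have := congrFun (congrFun (hHx t x) i) j
    simpa [Matrix.mul_apply, evalAt] using this
  -- The diagonal entries of `F` bound the factors, uniformly in the perturbation.
  have hbound : ∀ t (x : ℝ) i j, ‖(H t i j).eval (x : ℂ)‖ ≤
      (F j j).eval x + (x ^ 2 + 1) ^ m + 1 := fun t x i j => by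
    have h1 : (F j j).eval x + ε t * (x ^ 2 + 1) ^ m =
        ∑ l, ‖(H t l j).eval (x : ℂ)‖ ^ 2 := by
      have := hentry t x j j
      rw [one_apply_eq, Complex.ofReal_one, mul_one] at this
      simp only [Complex.conj_mul'] at this
      exact_mod_cast this
    have h2 : ‖(H t i j).eval (x : ℂ)‖ ^ 2 ≤ ∑ l, ‖(H t l j).eval (x : ℂ)‖ ^ 2 :=
      Finset.single_le_sum (f := fun l => ‖(H t l j).eval (x : ℂ)‖ ^ 2)
        (fun _ _ => by positivity) (Finset.mem_univ i)
    have h3 : ε t * (x ^ 2 + 1) ^ m ≤ (x ^ 2 + 1) ^ m :=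
      mul_le_of_le_one_left (by positivity) (hεle t)
    nlinarith [sq_nonneg (‖(H t i j).eval (x : ℂ)‖ - 1), sq_nonneg ‖(H t i j).eval (x : ℂ)‖]
  let node : Fin (m + 1) → ℂ := fun s => ((s : ℕ) : ℝ)
  have hnode : Set.InjOn node (Finset.univ : Finset (Fin (m + 1))) := fun a _ b _ h => by
    have : ((a : ℕ) : ℝ) = (b : ℕ) := Complex.ofReal_injective h
    exact Fin.ext (by exact_mod_cast this)
  let val : ℕ → Fin (m + 1) × Fin p × Fin p → ℂ := fun t a => (H t a.2.1 a.2.2).eval (node a.1)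
  obtain ⟨y, -, φ, hφ, hy⟩ := (isCompact_univ_pi fun a : Fin (m + 1) × Fin p × Fin p =>
    isCompact_closedBall (0 : ℂ) ((F a.2.2 a.2.2).eval ((a.1 : ℕ) : ℝ) +
      (((a.1 : ℕ) : ℝ) ^ 2 + 1) ^ m + 1)).tendsto_subseq (x := val) fun t a _ => by
        rw [mem_closedBall_zero_iff]
        exact hbound t _ _ _
  rw [tendsto_pi_nhds] at hy
  have hdegH : ∀ t i j, (H t i j).degree < (Finset.univ : Finset (Fin (m + 1))).card := by
    intro t i j
    rw [Finset.card_univ, Fintype.card_fin]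
    exact degree_lt_iff_coeff_zero _ _ |>.mpr fun c hc => coeff_eq_zero_of_natDegree_lt
      ((hH t i j).trans_lt (by omega))
  let G : Matrix (Fin p) (Fin p) ℂ[X] :=
    Matrix.of fun i j => Lagrange.interpolate Finset.univ node fun s => y (s, i, j)
  have hlim : ∀ (x : ℂ) i j, Tendsto (fun t => (H (φ t) i j).eval x) atTop
      (𝓝 ((G i j).eval x)) := fun x i j => by
    have : ∀ t, (H (φ t) i j).eval x = ∑ s, val (φ t) (s, i, j) *
        (Lagrange.basis Finset.univ node s).eval x := fun t => by
      rw [Lagrange.eq_interpolate hnode (hdegH (φ t) i j)]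
      simp [Lagrange.interpolate_apply, eval_finsetSum, val]
    simp only [this, G, of_apply, Lagrange.interpolate_apply, eval_finsetSum, eval_mul, eval_C]
    exact tendsto_finsetSum _ fun s _ => (hy (s, i, j)).mul_const _
  refine ⟨G, fun i j => ?_, fun x => ?_⟩
  · have := Lagrange.degree_interpolate_lt (fun s => y (s, i, j)) hnode
    rw [Finset.card_univ, Fintype.card_fin] at this
    exact natDegree_le_of_degree_le (Order.lt_succ_iff.mp this)
  · ext i j
    have hε0 : Tendsto (fun t => ε (φ t)) atTop (𝓝 0) :=
      tendsto_one_div_add_atTop_nhds_zero_nat.comp hφ.tendsto_atTop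
    have h1 : Tendsto (fun t => ((F i j).eval x + (ε (φ t) * (x ^ 2 + 1) ^ m) *
        (1 : Matrix (Fin p) (Fin p) ℝ) i j : ℂ)) atTop (𝓝 ((F i j).eval x : ℝ)) := by
      have h2 := (((hε0.mul_const ((x ^ 2 + 1) ^ m)).mul_const
        ((1 : Matrix (Fin p) (Fin p) ℝ) i j)).const_add ((F i j).eval x))
      rw [zero_mul, zero_mul, add_zero] at h2
      exact_mod_cast (Complex.continuous_ofReal.tendsto _).comp h2
    have h3 : Tendsto (fun t => ∑ l, conj ((H (φ t) l i).eval (x : ℂ)) *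
        (H (φ t) l j).eval (x : ℂ)) atTop
        (𝓝 (∑ l, conj ((G l i).eval (x : ℂ)) * (G l j).eval (x : ℂ))) :=
      tendsto_finsetSum _ fun l _ =>
        ((Complex.continuous_conj.tendsto _).comp (hlim x l i)).mul (hlim x l j)
    simp only [hentry] at h1
    simpa [Matrix.mul_apply, evalAt] using tendsto_nhds_unique h1 h3

/-- A real matrix polynomial that is positive semidefinite on the real line is a sum of two
symmetric squares. -/
theorem exists_two_squares {p m : ℕ} {F : MPoly p} (hF : PsdOn F Set.univ)
    (hd : ∀ i j, (F i j).natDegree ≤ 2 * m) :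
    ∃ H₁ H₂ : MPoly p, (∀ i j, (H₁ i j).natDegree ≤ m) ∧ (∀ i j, (H₂ i j).natDegree ≤ m) ∧
      F = H₁ᵀ * H₁ + H₂ᵀ * H₂ := by
  obtain ⟨H, hH, hHx⟩ := exists_factorization_complex hF hd
  choose R S hR hS hRS using fun i j => exists_re_im (H i j)
  refine ⟨Matrix.of R, Matrix.of S, fun i j => (hR i j).trans (hH i j),
    fun i j => (hS i j).trans (hH i j), eq_of_evalAt_eq_on Set.infinite_univ fun x _ => ?_⟩
  ext i j
  have := congrArg Complex.re (congrFun (congrFun (hHx x) i) j)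
  simp only [map_apply, Complex.ofReal_re, Matrix.mul_apply, conjTranspose_apply, hRS,
    Complex.re_sum, RCLike.star_def, Complex.mul_re, Complex.conj_re, Complex.conj_im] at this
  rw [this]
  simp [evalAt, Matrix.mul_apply, eval_finsetSum, Finset.sum_add_distrib]

end MatPoly

/-! ### Degrees, and positive semidefinite matrix polynomials on a half-line -/

namespace MatPoly

open Matrix

theorem deg_le_iff {p : ℕ} {F : MPoly p} {d : WithBot ℕ} :
    deg F ≤ d ↔ ∀ i j, (F i j).degree ≤ d := by
  simp [deg, Finset.sup_le_iff]

theorem deg_le_natCast_iff {p n : ℕ} {F : MPoly p} :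
    deg F ≤ (n : WithBot ℕ) ↔ ∀ i j, (F i j).natDegree ≤ n := by
  simp [deg_le_iff, natDegree_le_iff_degree_le]

theorem exists_deg_eq_natCast {p : ℕ} {F : MPoly p} (hF : F ≠ 0) : ∃ n : ℕ, deg F = n := by
  have : deg F ≠ ⊥ := fun h => hF <| by
    ext1 i j
    exact degree_eq_bot.mp (le_bot_iff.mp (deg_le_iff.mp h.le i j))
  obtain ⟨n, hn⟩ := WithBot.ne_bot_iff_exists.mp this
  exact ⟨n, hn.symm⟩

@[simp]
theorem deg_zero {p : ℕ} : deg (0 : MPoly p) = ⊥ :=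
  le_bot_iff.mp <| deg_le_iff.mpr fun i j => by simp

theorem deg_sub_le {p : ℕ} (F G : MPoly p) : deg (F - G) ≤ max (deg F) (deg G) :=
  deg_le_iff.mpr fun i j => (degree_sub_le _ _).trans <|
    max_le_max (deg_le_iff.mp le_rfl i j) (deg_le_iff.mp le_rfl i j)

theorem deg_add_le {p : ℕ} (F G : MPoly p) : deg (F + G) ≤ max (deg F) (deg G) :=
  deg_le_iff.mpr fun i j => (degree_add_le _ _).trans <|
    max_le_max (deg_le_iff.mp le_rfl i j) (deg_le_iff.mp le_rfl i j)

theorem deg_smul {p : ℕ} (g : ℝ[X]) (F : MPoly p) : deg (g • F) = g.degree + deg F := by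
  rw [deg, deg, Finset.apply_sup_eq_sup_comp_of_linearOrder (g.degree + ·)
    (fun _ _ h => add_le_add_right h _) (WithBot.add_bot _)]
  simp [Function.comp_def, degree_mul]

theorem deg_transpose_mul_self_le {p n : ℕ} {A : MPoly p}
    (hA : ∀ i j, 2 * (A i j).natDegree ≤ n) : deg (Aᵀ * A) ≤ (n : WithBot ℕ) := by
  refine deg_le_natCast_iff.mpr fun i j => ?_
  rw [Matrix.mul_apply]
  refine natDegree_sum_le_of_forall_le _ _ fun l _ => natDegree_mul_le.trans ?_
  rw [transpose_apply]
  linarith [hA l i, hA l j]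

theorem deg_smul_transpose_mul_self_le {p n : ℕ} {B : MPoly p} {g : ℝ[X]} (hg : g.natDegree ≤ 1)
    (hB : ∀ i j, B i j ≠ 0 → 2 * (B i j).natDegree + 1 ≤ n) :
    deg (g • (Bᵀ * B)) ≤ (n : WithBot ℕ) := by
  refine deg_le_natCast_iff.mpr fun i j => ?_
  rw [Matrix.smul_apply, Matrix.mul_apply, Finset.smul_sum]
  refine natDegree_sum_le_of_forall_le _ _ fun l _ => ?_
  rw [transpose_apply, smul_eq_mul]
  by_cases h1 : B l i = 0
  · simp [h1]
  by_cases h2 : B l j = 0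
  · simp [h2]
  have h := natDegree_mul_le_of_le hg (natDegree_mul_le (p := B l i) (q := B l j))
  linarith [hB l i h1, hB l j h2]

/-- Even and odd part of a polynomial, in the variable `x ^ 2 + b`. -/
theorem exists_even_odd (b : ℝ) (q : ℝ[X]) : ∃ e o : ℝ[X], 2 * e.natDegree ≤ q.natDegree ∧
    (o ≠ 0 → 2 * o.natDegree + 1 ≤ q.natDegree) ∧
    ∀ x, q.eval x = e.eval (x ^ 2 + b) + x * o.eval (x ^ 2 + b) := by
  have hq : q = expand ℝ 2 (contract 2 q) + X * expand ℝ 2 (contract 2 q.divX) := by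
    ext n
    rcases n with _ | n
    · simp [coeff_expand, coeff_contract]
    · rw [coeff_add, coeff_X_mul, coeff_expand two_pos, coeff_expand two_pos]
      rcases Nat.even_or_odd' n with ⟨c, rfl | rfl⟩
      · simp [coeff_contract, mul_comm]
      · have h1 : 2 ∣ 2 * c + 1 + 1 := by omega
        have h2 : ¬ 2 ∣ 2 * c + 1 := by omega
        have h3 : (2 * c + 1 + 1) / 2 * 2 = 2 * c + 1 + 1 := by omega
        simp [h1, h2, coeff_contract, h3]
  have hcomp : ∀ f : ℝ[X], (f.comp (X - C b)).natDegree = f.natDegree := fun f => by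
    rw [natDegree_comp, natDegree_X_sub_C, mul_one]
  refine ⟨(contract 2 q).comp (X - C b), (contract 2 q.divX).comp (X - C b), ?_, ?_, fun x => ?_⟩
  · rw [hcomp]
    by_cases h : contract 2 q = 0
    · simp [h]
    · have h1 : (contract 2 q).coeff (contract 2 q).natDegree ≠ 0 := leadingCoeff_ne_zero.mpr h
      rw [coeff_contract two_ne_zero] at h1
      have := le_natDegree_of_ne_zero h1
      omega
  · rw [hcomp]
    intro h
    have h' : contract 2 q.divX ≠ 0 := fun h0 => h (by rw [h0, zero_comp])
    have h1 : (contract 2 q.divX).coeff (contract 2 q.divX).natDegree ≠ 0 :=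
      leadingCoeff_ne_zero.mpr h'
    rw [coeff_contract two_ne_zero, coeff_divX] at h1
    have := le_natDegree_of_ne_zero h1
    omega
  · conv_lhs => rw [hq]
    simp [expand_eval]

/-- A matrix polynomial that is positive semidefinite on a half-line `[b, ∞)` is a combination of
symmetric squares with weights `1` and `X - b`: substitute `x ^ 2 + b` and separate the even and
odd parts of the factors on the real line. -/
theorem exists_squares_of_psdOn_Ici {p n : ℕ} {F : MPoly p} {b : ℝ} (hF : PsdOn F (Set.Ici b))
    (hd : ∀ i j, (F i j).natDegree ≤ n) :
    ∃ A₁ A₂ B₁ B₂ : MPoly p, (∀ i j, 2 * (A₁ i j).natDegree ≤ n) ∧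
      (∀ i j, 2 * (A₂ i j).natDegree ≤ n) ∧
      (∀ i j, B₁ i j ≠ 0 → 2 * (B₁ i j).natDegree + 1 ≤ n) ∧
      (∀ i j, B₂ i j ≠ 0 → 2 * (B₂ i j).natDegree + 1 ≤ n) ∧
      F = A₁ᵀ * A₁ + A₂ᵀ * A₂ + (X - C b) • (B₁ᵀ * B₁ + B₂ᵀ * B₂) := by
  have heval : ∀ x, evalAt x (F.map fun q => q.comp (X ^ 2 + C b)) = evalAt (x ^ 2 + b) F :=
    fun x => by
      ext i j
      simp [evalAt]
  obtain ⟨H₁, H₂, h1, h2, hH⟩ := exists_two_squares (m := n)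
    (F := F.map fun q => q.comp (X ^ 2 + C b))
    (fun x _ => by
      rw [heval]
      exact hF _ (by simp [sq_nonneg]))
    (fun i j => by
      rw [map_apply, natDegree_comp, natDegree_X_pow_add_C, mul_comm]
      exact Nat.mul_le_mul_left 2 (hd i j))
  choose A₁ B₁ hA₁ hB₁ e₁ using fun i j => exists_even_odd b (H₁ i j)
  choose A₂ B₂ hA₂ hB₂ e₂ using fun i j => exists_even_odd b (H₂ i j)
  have he₁ : ∀ x, evalAt x H₁ =
      evalAt (x ^ 2 + b) (Matrix.of A₁) + x • evalAt (x ^ 2 + b) (Matrix.of B₁) := fun x => by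
    ext i j
    exact e₁ i j x
  have he₂ : ∀ x, evalAt x H₂ =
      evalAt (x ^ 2 + b) (Matrix.of A₂) + x • evalAt (x ^ 2 + b) (Matrix.of B₂) := fun x => by
    ext i j
    exact e₂ i j x
  refine ⟨Matrix.of A₁, Matrix.of A₂, Matrix.of B₁, Matrix.of B₂,
    fun i j => (hA₁ i j).trans (h1 i j), fun i j => (hA₂ i j).trans (h2 i j),
    fun i j h => (hB₁ i j h).trans (h1 i j), fun i j h => (hB₂ i j h).trans (h2 i j),
    eq_of_evalAt_eq_on (Set.Ici_infinite b) fun t ht => ?_⟩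
  obtain ⟨s, hx⟩ : ∃ s, s ^ 2 = t - b := ⟨_, Real.sq_sqrt (sub_nonneg.mpr ht)⟩
  -- The two square roots of `t - b` give two expressions of `F t`; their mean has no cross terms.
  have hpos := congrArg (evalAt s) hH
  have hneg := congrArg (evalAt (-s)) hH
  rw [heval] at hpos hneg
  simp only [evalAt_add, evalAt_mul, evalAt_transpose, he₁, he₂, neg_sq, hx, sub_add_cancel]
    at hpos hneg
  have hmean : evalAt t F = (1 / 2 : ℝ) • (evalAt t F + evalAt t F) := by
    rw [← two_smul ℝ, smul_smul]; norm_num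
  rw [hmean]
  nth_rewrite 1 [hpos]
  rw [hneg]
  simp only [evalAt_add, evalAt_mul, evalAt_transpose, evalAt_smul, eval_sub, eval_X, eval_C, ← hx,
    transpose_add, transpose_smul, add_mul, mul_add, Matrix.smul_mul, Matrix.mul_smul]
  module

theorem exists_sumTwoSquares_of_psdOn_Ici {p : ℕ} {F : MPoly p} {b : ℝ}
    (hF : PsdOn F (Set.Ici b)) :
    ∃ S T : MPoly p, IsSumTwoSquares S ∧ IsSumTwoSquares T ∧ F = S + (X - C b) • T ∧
      deg S ≤ deg F ∧ deg ((X - C b) • T) ≤ deg F := by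
  by_cases h0 : F = 0
  · exact ⟨0, 0, ⟨0, 0, by simp⟩, ⟨0, 0, by simp⟩, by simp [h0]⟩
  obtain ⟨n, hn⟩ := exists_deg_eq_natCast h0
  obtain ⟨A₁, A₂, B₁, B₂, hA₁, hA₂, hB₁, hB₂, h⟩ :=
    exists_squares_of_psdOn_Ici hF (deg_le_natCast_iff.mp hn.le)
  refine ⟨_, _, ⟨A₁, A₂, rfl⟩, ⟨B₁, B₂, rfl⟩, h, ?_, ?_⟩
  · rw [hn]
    exact (deg_add_le _ _).trans
      (max_le (deg_transpose_mul_self_le hA₁) (deg_transpose_mul_self_le hA₂))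
  · rw [hn, smul_add]
    exact (deg_add_le _ _).trans
      (max_le (deg_smul_transpose_mul_self_le (natDegree_X_sub_C b).le hB₁)
        (deg_smul_transpose_mul_self_le (natDegree_X_sub_C b).le hB₂))

end MatPoly

/-! ### Subtracting a square with a prescribed value at a point -/

namespace MatPoly

open Matrix
open scoped MatrixOrder

/-- The pseudo-inverse of a symmetric matrix. -/
theorem exists_pseudoInverse {n : Type*} [Fintype n] [DecidableEq n] {M : Matrix n n ℝ}
    (hM : M.IsHermitian) : ∃ N : Matrix n n ℝ, Nᵀ = N ∧ N * M * N = N ∧ M * N * M = M := by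
  obtain ⟨φ, d, rfl⟩ : ∃ (φ : Matrix n n ℝ ≃⋆ₐ[ℝ] Matrix n n ℝ) (d : n → ℝ), M = φ (diagonal d) :=
    ⟨_, _, hM.spectral_theorem⟩
  -- Eigenvalues zero are kept, by the convention for the inverse of zero.
  refine ⟨φ (diagonal fun i => (d i)⁻¹), ?_, ?_, ?_⟩
  · rw [← conjTranspose_eq_transpose_of_trivial, ← star_eq_conjTranspose, ← map_star,
      star_eq_conjTranspose, diagonal_conjTranspose]
    rfl
  · rw [← map_mul, ← map_mul, diagonal_mul_diagonal, diagonal_mul_diagonal]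
    congr 2
    ext i
    by_cases h : d i = 0 <;> simp [h]
  · rw [← map_mul, ← map_mul, diagonal_mul_diagonal, diagonal_mul_diagonal]
    congr 2
    ext i
    by_cases h : d i = 0 <;> simp [h]

/-- The kernel of a positive semidefinite matrix `M` is contained in that of each smaller one. -/
theorem mul_pseudoInverse_mul {n : Type*} [Fintype n] [DecidableEq n] {M N P : Matrix n n ℝ}
    (hP : P.PosSemidef) (hPM : (M - P).PosSemidef) (hN : M * N * M = M) : P * N * M = P := by
  have h : ∀ v, P *ᵥ ((1 - N * M) *ᵥ v) = 0 := fun v => by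
    have hMv : M *ᵥ ((1 - N * M) *ᵥ v) = 0 := by
      rw [mulVec_mulVec, mul_sub, mul_one, ← Matrix.mul_assoc, hN, sub_self, zero_mulVec]
    rw [← hP.dotProduct_mulVec_zero_iff]
    have h1 := hPM.dotProduct_mulVec_nonneg ((1 - N * M) *ᵥ v)
    rw [sub_mulVec M P, hMv, zero_sub, dotProduct_neg] at h1
    exact le_antisymm (neg_nonneg.mp h1) (hP.dotProduct_mulVec_nonneg _)
  have : P * (1 - N * M) = 0 := by
    ext1 i j
    have := congrFun (h (Pi.single j 1)) i
    rw [mulVec_mulVec] at this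
    simpa using this
  rw [mul_sub, mul_one, ← Matrix.mul_assoc, sub_eq_zero] at this
  exact this.symm

/-- Below a sum of two squares `W₁ᵀ W₁ + W₂ᵀ W₂` there is a square with any prescribed value
at the point `a` between zero and the value of that sum. With `M` the value of the sum, `N` its
pseudo-inverse and `P = Rᵀ R` the prescribed value, the square of
`R N (W₁(a)ᵀ W₁ + W₂(a)ᵀ W₂)` does it. -/
theorem exists_square_le {p m : ℕ} {W₁ W₂ : MPoly p} {a : ℝ}
    {P : Matrix (Fin p) (Fin p) ℝ} (hP : P.PosSemidef)
    (hle : (evalAt a (W₁ᵀ * W₁ + W₂ᵀ * W₂) - P).PosSemidef)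
    (h₁ : ∀ i j, 2 * (W₁ i j).natDegree ≤ m) (h₂ : ∀ i j, 2 * (W₂ i j).natDegree ≤ m) :
    ∃ H : MPoly p, (∀ i j, 2 * (H i j).natDegree ≤ m) ∧ evalAt a (Hᵀ * H) = P ∧
      ∀ x, (evalAt x (W₁ᵀ * W₁ + W₂ᵀ * W₂ - Hᵀ * H)).PosSemidef := by
  obtain ⟨R, hR⟩ := CStarAlgebra.nonneg_iff_eq_star_mul_self.mp hP.nonneg
  rw [star_eq_conjTranspose, conjTranspose_eq_transpose_of_trivial] at hR
  set U : Matrix (Fin p) (Fin p) ℝ := evalAt a W₁ with hU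
  set V : Matrix (Fin p) (Fin p) ℝ := evalAt a W₂ with hV
  set M := Uᵀ * U + Vᵀ * V with hM
  have hMa : evalAt a (W₁ᵀ * W₁ + W₂ᵀ * W₂) = M := by
    simp only [evalAt_add, evalAt_mul, evalAt_transpose, hM, hU, hV]
  rw [hMa] at hle
  have hMh : M.IsHermitian := by
    have := hle.isHermitian.add hP.isHermitian
    rwa [sub_add_cancel] at this
  obtain ⟨N, hNt, hNMN, hMNM⟩ := exists_pseudoInverse hMh
  have hPNM : P * N * M = P := mul_pseudoInverse_mul hP hle hMNM
  have hPt : Pᵀ = P := hP.isHermitian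
  have hMNP : M * N * P = P := by
    have := congrArg transpose hPNM
    rwa [transpose_mul, transpose_mul, hNt, hPt, show Mᵀ = M from hMh, ← Matrix.mul_assoc] at this
  have hH : ∀ x, evalAt x ((R * N * Uᵀ).map C * W₁ + (R * N * Vᵀ).map C * W₂) =
      R * N * (Uᵀ * evalAt x W₁ + Vᵀ * evalAt x W₂) := fun x => by
    rw [evalAt_add, evalAt_mul, evalAt_mul]
    simp only [evalAt, map_C_map_eval]
    simp only [Matrix.mul_assoc, mul_add]
  have hHH : ∀ x, evalAt x (((R * N * Uᵀ).map C * W₁ + (R * N * Vᵀ).map C * W₂)ᵀ *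
      ((R * N * Uᵀ).map C * W₁ + (R * N * Vᵀ).map C * W₂)) =
      (Uᵀ * evalAt x W₁ + Vᵀ * evalAt x W₂)ᵀ * (N * P * N) *
        (Uᵀ * evalAt x W₁ + Vᵀ * evalAt x W₂) := fun x => by
    rw [evalAt_mul, evalAt_transpose, hH, transpose_mul, transpose_mul, hNt, hR]
    simp only [Matrix.mul_assoc]
  have hdeg : ∀ (A : Matrix (Fin p) (Fin p) ℝ) (W : MPoly p),
      (∀ i j, 2 * (W i j).natDegree ≤ m) → ∀ i j, ((A.map C * W) i j).natDegree ≤ m / 2 := by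
    intro A W hW i j
    rw [Matrix.mul_apply]
    refine natDegree_sum_le_of_forall_le _ _ fun l _ => (natDegree_C_mul_le _ _).trans ?_
    have := hW l j
    omega
  refine ⟨(R * N * Uᵀ).map C * W₁ + (R * N * Vᵀ).map C * W₂, fun i j => ?_, ?_, fun x => ?_⟩
  · have := natDegree_add_le_of_degree_le (hdeg (R * N * Uᵀ) W₁ h₁ i j)
      (hdeg (R * N * Vᵀ) W₂ h₂ i j)
    rw [Matrix.add_apply]
    omega
  · rw [hHH, ← hU, ← hV, ← hM, show Mᵀ = M from hMh]
    calc M * (N * P * N) * M = M * N * (P * N * M) := by simp only [Matrix.mul_assoc]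
      _ = P := by rw [hPNM, hMNP]
  · rw [evalAt_sub, hHH]
    simp only [evalAt_add, evalAt_mul, evalAt_transpose]
    set Y := evalAt x W₁
    set Z := evalAt x W₂
    set T := Uᵀ * Y + Vᵀ * Z with hT
    -- The difference of the sum and the square is a sum of two squares, the distance of `(Y, Z)`
    -- from its projection to the range of `(U, V)`, and of a congruence of `M - P`.
    have key : Yᵀ * Y + Zᵀ * Z - Tᵀ * (N * P * N) * T =
        (Y - U * N * T)ᵀ * (Y - U * N * T) + (Z - V * N * T)ᵀ * (Z - V * N * T) +
          (N * T)ᵀ * (M - P) * (N * T) := by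
      have e1 : (Y - U * N * T)ᵀ * (Y - U * N * T) + (Z - V * N * T)ᵀ * (Z - V * N * T) =
          Yᵀ * Y + Zᵀ * Z - (Yᵀ * U + Zᵀ * V) * (N * T) - Tᵀ * N * (Uᵀ * Y + Vᵀ * Z) +
            Tᵀ * (N * M * N) * T := by
        rw [hM]
        simp only [transpose_sub, transpose_mul, hNt]
        noncomm_ring
      have e2 : Yᵀ * U + Zᵀ * V = Tᵀ := by simp [hT, transpose_mul]
      rw [e1, e2, ← hT, hNMN, transpose_mul, hNt]
      have e3 : Tᵀ * N * (M - P) * (N * T) = Tᵀ * (N * M * N) * T - Tᵀ * (N * P * N) * T := by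
        noncomm_ring
      rw [e3, hNMN]
      noncomm_ring
    rw [key]
    exact ((posSemidef_conjTranspose_mul_self _).add (posSemidef_conjTranspose_mul_self _)).add
      (hle.conjTranspose_mul_mul_same _)

theorem exists_eq_X_sub_C_smul {p : ℕ} {F : MPoly p} {a : ℝ} (h : evalAt a F = 0) :
    ∃ B : MPoly p, F = (X - C a) • B := by
  have : ∀ i j, ∃ q, F i j = (X - C a) * q := fun i j =>
    dvd_iff_isRoot.mpr (congrFun (congrFun h i) j)
  choose B hB using this
  exact ⟨Matrix.of B, by ext1 i j; exact hB i j⟩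

/-- The decomposition on a point and a half-line. The part of a decomposition on `[b, ∞)` without
the factor `X - b` exceeds `F` at `a`; a square below it with the value `F a` is subtracted,
and the quotient of the rest by `X - a` is decomposed on `[b, ∞)`. -/
theorem exists_decomposition {p : ℕ} {a b : ℝ} (hab : a < b) {F : MPoly p}
    (hF : PsdOn F ({a} ∪ Set.Ici b)) :
    ∃ G₀ G₁ G₂ : MPoly p, IsSumTwoSquares G₀ ∧ IsSumTwoSquares G₁ ∧ IsSumTwoSquares G₂ ∧
      F = G₀ + (X - C a) • G₁ + ((X - C a) * (X - C b)) • G₂ ∧ deg G₀ ≤ deg F ∧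
      deg ((X - C a) • G₁) ≤ deg F ∧ deg (((X - C a) * (X - C b)) • G₂) ≤ deg F := by
  by_cases h0 : F = 0
  · exact ⟨0, 0, 0, ⟨0, 0, by simp⟩, ⟨0, 0, by simp⟩, ⟨0, 0, by simp⟩, by simp [h0]⟩
  obtain ⟨n, hn⟩ := exists_deg_eq_natCast h0
  obtain ⟨A₁, A₂, B₁, B₂, hA₁, hA₂, -, -, h⟩ := exists_squares_of_psdOn_Ici
    (fun x hx => hF x (Or.inr hx)) (deg_le_natCast_iff.mp hn.le)
  have hsq : ∀ x, (evalAt x (B₁ᵀ * B₁ + B₂ᵀ * B₂)).PosSemidef := fun x => by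
    rw [evalAt_add, evalAt_mul, evalAt_mul]
    exact (posSemidef_conjTranspose_mul_self _).add (posSemidef_conjTranspose_mul_self _)
  have hFx : ∀ x, evalAt x F = evalAt x (A₁ᵀ * A₁ + A₂ᵀ * A₂) +
      (x - b) • evalAt x (B₁ᵀ * B₁ + B₂ᵀ * B₂) := fun x => by
    conv_lhs => rw [h, evalAt_add, evalAt_smul, eval_sub, eval_X, eval_C]
  obtain ⟨H, hHdeg, hHa, hHle⟩ := exists_square_le (hF a (Or.inl rfl)) (W₁ := A₁) (W₂ := A₂)
    (by
      have := (hsq a).smul (sub_nonneg.mpr hab.le)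
      rw [hFx a]
      convert this using 1
      module) hA₁ hA₂
  obtain ⟨B, hB⟩ := exists_eq_X_sub_C_smul (F := F - Hᵀ * H) (a := a)
    (by rw [evalAt_sub, hHa, sub_self])
  have hBpsd : PsdOn B (Set.Ici b) := fun x hx => by
    have hxa : 0 < x - a := sub_pos.mpr (hab.trans_le hx)
    have hxb : 0 ≤ x - b := sub_nonneg.mpr hx
    have h1 := congrArg (evalAt x) hB
    rw [evalAt_smul, eval_sub, eval_X, eval_C, evalAt_sub, hFx x] at h1
    have h2 := ((hHle x).add ((hsq x).smul hxb)).smul (inv_nonneg.mpr hxa.le)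
    convert h2 using 1
    rw [eq_inv_smul_iff₀ hxa.ne', ← h1, evalAt_sub]
    module
  have hHn : deg (Hᵀ * H) ≤ deg F := hn ▸ deg_transpose_mul_self_le hHdeg
  have hBn : deg ((X - C a) • B) ≤ deg F := hB ▸ (deg_sub_le _ _).trans (max_le le_rfl hHn)
  obtain ⟨G₁, G₂, hG₁, hG₂, hG, hd₁, hd₂⟩ := exists_sumTwoSquares_of_psdOn_Ici hBpsd
  refine ⟨Hᵀ * H, G₁, G₂, ⟨H, 0, by simp⟩, hG₁, hG₂, ?_, hHn, ?_, ?_⟩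
  · rw [add_assoc, mul_smul, ← smul_add, ← hG, ← hB, add_sub_cancel]
  · refine le_trans ?_ hBn
    rw [deg_smul, deg_smul]
    exact add_le_add_right hd₁ _
  · refine le_trans ?_ hBn
    rw [mul_smul, deg_smul, deg_smul _ B]
    exact add_le_add_right hd₂ _

end MatPoly

/-! ### The natural description and the preordering -/

namespace MatPoly

open Matrix

/-- The natural description of a point and a half-line. -/
theorem naturalDescription_singleton_union_Ici {a b : ℝ} (hab : a < b) :
    naturalDescription ({a} ∪ Set.Ici b) = {X - C a, (X - C a) * (X - C b)} := by
  have hleast : IsLeast ({a} ∪ Set.Ici b) a := by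
    refine ⟨Or.inl rfl, ?_⟩
    rintro x (rfl | hx)
    · exact le_rfl
    · exact hab.le.trans hx
  ext g
  constructor
  · rintro (⟨c, hc, rfl⟩ | ⟨c, hc, rfl⟩ | ⟨c, d, hc, hd, hcd, hdisj, rfl⟩)
    · rw [hc.unique hleast]
      exact Or.inl rfl
    · have := hc.2 (Or.inr (show b ≤ max b c + 1 by linarith [le_max_left b c]))
      linarith [le_max_right b c]
    · have hmid : ∀ x, c < x → x < d → ¬ b ≤ x := fun x h1 h2 h3 =>
        Set.disjoint_left.mp hdisj ⟨h1, h2⟩ (Or.inr h3)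
      have hcb : c < b := by
        by_contra! h
        exact hmid ((c + d) / 2) (by linarith) (by linarith) (by linarith)
      have hca : c = a := hc.resolve_right (not_le.mpr hcb)
      subst hca
      have hbd : b ≤ d := hd.resolve_left (ne_of_gt hcd)
      have : d = b := le_antisymm (not_lt.mp fun h => hmid b hcb h le_rfl) hbd
      rw [this]
      exact Or.inr rfl
  · rintro (rfl | rfl)
    · exact Or.inl ⟨a, hleast, rfl⟩
    · refine Or.inr (Or.inr ⟨a, b, Or.inl rfl, Or.inr Set.self_mem_Ici, hab, ?_, rfl⟩)
      rw [Set.disjoint_left]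
      rintro x ⟨h1, h2⟩ (rfl | h3)
      · exact lt_irrefl _ h1
      · exact (not_le.mpr h2) h3

theorem nonnegSet_pair {a b : ℝ} (hab : a < b) :
    nonnegSet {X - C a, (X - C a) * (X - C b)} = {a} ∪ Set.Ici b := by
  ext x
  simp only [nonnegSet, Set.mem_ofPred_eq, Set.mem_insert_iff, Set.mem_singleton_iff,
    forall_eq_or_imp, forall_eq, eval_mul, eval_sub, eval_X, eval_C, Set.mem_union, Set.mem_Ici,
    sub_nonneg]
  constructor
  · rintro ⟨h1, h2⟩
    rcases h1.eq_or_lt with h | h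
    · exact Or.inl h.symm
    · exact Or.inr (sub_nonneg.mp (nonneg_of_mul_nonneg_right h2 (sub_pos.mpr h)))
  · rintro (rfl | h)
    · simp
    · exact ⟨by linarith, mul_nonneg (by linarith) (by linarith)⟩

theorem IsSumTwoSquares.mem_sumSquares {p : ℕ} {G : MPoly p} (h : IsSumTwoSquares G) :
    G ∈ sumSquares p := by
  obtain ⟨H₁, H₂, rfl⟩ := h
  exact add_mem (AddSubmonoid.subset_closure ⟨H₁, rfl⟩) (AddSubmonoid.subset_closure ⟨H₂, rfl⟩)

theorem isSymm_and_posSemidef_of_mem_sumSquares {p : ℕ} {G : MPoly p} (h : G ∈ sumSquares p) :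
    G.IsSymm ∧ ∀ x, (evalAt x G).PosSemidef := by
  induction h using AddSubmonoid.closure_induction with
  | mem G hG =>
    obtain ⟨H, rfl⟩ := hG
    refine ⟨isSymm_transpose_mul_self H, fun x => ?_⟩
    rw [evalAt_mul]
    exact posSemidef_conjTranspose_mul_self _
  | zero =>
    refine ⟨isSymm_zero, fun x => ?_⟩
    convert PosSemidef.zero (R := ℝ)
    ext
    simp [evalAt]
  | add G G' _ _ h h' =>
    exact ⟨h.1.add h'.1, fun x => by rw [evalAt_add]; exact (h.2 x).add (h'.2 x)⟩

theorem preordering_subset_positives (p : ℕ) (S : Set ℝ[X]) :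
    preordering p S ⊆ positives p (nonnegSet S) := by
  rintro F ⟨P, σ, hP, rfl⟩
  refine ⟨?_, fun x hx => ?_⟩
  · rw [IsSymm, transpose_sum]
    refine Finset.sum_congr rfl fun T hT => ?_
    rw [transpose_smul, (isSymm_and_posSemidef_of_mem_sumSquares (hP T hT).2).1.eq]
  · have : evalAt x (∑ T ∈ P, (∏ g ∈ T, g) • σ T) =
        ∑ T ∈ P, (∏ g ∈ T, g.eval x) • evalAt x (σ T) := by
      ext i j
      simp [evalAt, Matrix.sum_apply, eval_finsetSum, eval_prod]
    rw [this]
    exact posSemidef_sum _ fun T hT =>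
      ((isSymm_and_posSemidef_of_mem_sumSquares (hP T hT).2).2 x).smul
        (Finset.prod_nonneg fun g hg => hx g ((hP T hT).1 hg))

theorem smul_mem_preordering_pair {p : ℕ} {g h : ℝ[X]} {G₀ G₁ G₂ : MPoly p} (hgh : g ≠ h)
    (h₀ : G₀ ∈ sumSquares p) (h₁ : G₁ ∈ sumSquares p) (h₂ : G₂ ∈ sumSquares p) :
    G₀ + g • G₁ + h • G₂ ∈ preordering p {g, h} := by
  classical
  have e1 : ({g} : Finset ℝ[X]) ≠ ∅ := Finset.singleton_ne_empty g
  have e2 : ({h} : Finset ℝ[X]) ≠ ∅ := Finset.singleton_ne_empty h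
  have e3 : ({h} : Finset ℝ[X]) ≠ {g} := fun e => hgh (Finset.singleton_injective e).symm
  refine ⟨{∅, {g}, {h}}, fun T => if T = ∅ then G₀ else if T = {g} then G₁ else G₂, ?_, ?_⟩
  · intro T hT
    simp only [Finset.mem_insert, Finset.mem_singleton] at hT
    rcases hT with rfl | rfl | rfl
    · simpa using h₀
    · simpa using h₁
    · simpa [e3] using h₂
  · rw [Finset.sum_insert (by simp [e1.symm, e2.symm]), Finset.sum_insert (by simp [e3.symm]),
      Finset.sum_singleton]
    simp [e3, add_assoc]

end MatPoly

theorem mainTheorem2 (p : ℕ) (a b : ℝ) (hab : a < b) :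
    (∀ F : MatPoly.MPoly p, F.IsSymm → MatPoly.PsdOn F ({a} ∪ Set.Ici b) →
      ∃ G₀ G₁ G₂ G₃ : MatPoly.MPoly p,
        MatPoly.IsSumTwoSquares G₀ ∧ MatPoly.IsSumTwoSquares G₁ ∧
        MatPoly.IsSumTwoSquares G₂ ∧ MatPoly.IsSumTwoSquares G₃ ∧
        F = G₀ + (X - C a) • G₁ + ((X - C a) * (X - C b)) • G₂
              + ((X - C a) ^ 2 * (X - C b)) • G₃ ∧
        MatPoly.deg G₀ ≤ MatPoly.deg F ∧
        MatPoly.deg ((X - C a) • G₁) ≤ MatPoly.deg F ∧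
        MatPoly.deg (((X - C a) * (X - C b)) • G₂) ≤ MatPoly.deg F ∧
        MatPoly.deg (((X - C a) ^ 2 * (X - C b)) • G₃) ≤ MatPoly.deg F) ∧
    MatPoly.nonnegSet (MatPoly.naturalDescription ({a} ∪ Set.Ici b)) = {a} ∪ Set.Ici b ∧
    MatPoly.IsSaturated p (MatPoly.naturalDescription ({a} ∪ Set.Ici b)) := by
  rw [MatPoly.IsSaturated, MatPoly.naturalDescription_singleton_union_Ici hab]
  refine ⟨fun F _ hF => ?_, MatPoly.nonnegSet_pair hab,
    (MatPoly.preordering_subset_positives p _).antisymm fun F hF => ?_⟩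
  · obtain ⟨G₀, G₁, G₂, h₀, h₁, h₂, h, d₀, d₁, d₂⟩ := MatPoly.exists_decomposition hab hF
    -- The last summand is redundant.
    exact ⟨G₀, G₁, G₂, 0, h₀, h₁, h₂, ⟨0, 0, by simp⟩, by simpa using h, d₀, d₁, d₂, by simp⟩
  · rw [MatPoly.nonnegSet_pair hab] at hF
    obtain ⟨G₀, G₁, G₂, h₀, h₁, h₂, h, -⟩ := MatPoly.exists_decomposition hab hF.2
    have hne : X - C a ≠ (X - C a) * (X - C b) := fun e => by
      have := congrArg natDegree e
      rw [natDegree_mul (X_sub_C_ne_zero a) (X_sub_C_ne_zero b), natDegree_X_sub_C,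
        natDegree_X_sub_C] at this
      omega
    rw [h]
    exact MatPoly.smul_mem_preordering_pair hne h₀.mem_sumSquares h₁.mem_sumSquares
      h₂.mem_sumSquares
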